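/- **Corollary (overall SINR coverage).** *Setting.* Base stations (BSs) of height $h_B>0$ and transmit power $P_t$ lie along a road. The serving BS is at the origin, its inter-BS distance $d_a$ has density $f_{d_a}(y)=2\lambda e^{-2\lambda y}$ ($y\ge 0$), and given $d_a=y$ the distance $d$ of the typical user from the serving BS is uniform on $[0,y]$, with density $f_d(x\mid y)=y^{-1}\mathbf 1_{0\le x\le y}$. The angle of arrival $\psi$ is uniform on $[0,2\pi]$, with density $f(\psi)=\frac1{2\pi}$. In coordinates centred at the user, the other BSs form a homogeneous Poisson point process of intensity $\lambda$ on $\mathbb R$, restricted to points farther from the user than the serving BS. A link of length $r$ is LOS if $r\le d_S$ and NLOS otherwise; it has path loss $K(r^2+h_B^2)^{-\alpha/2}$ and Nakagami fading with $|f|^2\sim\mathrm{Gamma}(m,m)$ (shape and rate $m$), where $(\alpha,m)=(\alpha_L,N_L)$ for LOS and $(\alpha_N,N_N)$ for NLOS links, with $N_L,N_N$ positive integers. All fading variables are independent; the fading, the point process, the pair $(d_a,d)$, $\psi$ and the estimation errors below are mutually independent. *Beams.* The BS uses beams of width $\theta_k\in(0,\pi/2)$. A cell of length $y$ has $N(y)=\lceil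 \arctan(y/h_B)/\theta_k\rceil$ of them; beam $j$ covers $\mathcal C_j=[d_{L_j},d_{R_j}]$, where $d_{L_j}=h_B\tan((j-1)\theta_k)$, and $d_{R_j}=h_B\tan(j\theta_k)$ if $j\theta_k<\pi/2$, $d_{R_j}=\infty$ otherwise. An antenna of beamwidth $\vartheta$ has main-lobe gain $\gamma(\vartheta)=G_0\frac{2\pi-(2\pi-\vartheta)\epsilon}{\vartheta}$ and side-lobe gain $g=G_0\epsilon$, $0<\epsilon<1$. The user beam has width $\theta_U\in(0,2\pi]$. *Localization errors.* Given $d=x$, the estimate $\hat d$ is $\mathcal N(x,\sigma_d^2(x))$; given $d=x$ and $\psi$, the estimate $\hat\psi$ is $\mathcal N(\psi,\sigma_\psi^2(x,\psi))$, where $\sigma_d^2$ and $\sigma_\psi^2$ are any measurable finite variance functions. For a user in $\mathcal C_j$ at distance $x$, a beam-selection error is the event $\hat d\notin\mathcal C_j$ and misalignment is the event $|\psi-\hat\psi|\ge\nu$, where $\nu>0$ is fixed. Write $\mathcal P_{BS,j}(x)=\mathbb P(\hat d\notin\mathcal C_j\mid d=x)$ and $\mathcal P_{MA}(x,\psi)=\mathbb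 P(|\psi-\hat\psi|\ge\nu\mid d=x,\psi)$. *SINR.* At distance $x$ with BS gain $G_B$ and user gain $G_U$, $$\mathrm{SINR}(x,G_B,G_U)=\frac{KP_t|f|^2G_BG_U(h_B^2+x^2)^{-\alpha/2}}{N_0B+\sum_{i}KP_t|f_i|^2g^2(h_B^2+d_i^2)^{-\alpha_i/2}},$$ where the sum runs over the BSs at distance $d_i>x$ from the user. The gains $(G_B,G_U)$ of the typical user are $(g,g)$ after a beam-selection error, $(\gamma(\theta_k),g)$ if there is no such error but misalignment, and $(\gamma(\theta_k),\gamma(\theta_U))$ otherwise. For $T>0$ let $\mathcal T_0(x,T)$, $\mathcal T_{MA}(x,T)$, $\mathcal T_{BS}(x,T)$ be $\mathbb P(\mathrm{SINR}(x,G_B,G_U)\ge T)$ for $(G_B,G_U)=(\gamma(\theta_k),\gamma(\theta_U))$, $(\gamma(\theta_k),g)$, $(g,g)$, respectively, and set $$\mathcal P_C(T,j\mid y)=\int_0^{2\pi}\!\!\int_{d_{L_j}}^{d_{R_j}}\Big[\mathcal P_{BS,j}(x)\mathcal T_{BS}(x,T)+(1-\mathcal P_{BS,j}(x))\big((1-\mathcal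 P_{MA}(x,\psi))\mathcal T_0(x,T)+\mathcal P_{MA}(x,\psi)\mathcal T_{MA}(x,T)\big)\Big]f_d(x\mid y)f(\psi)\,dx\,d\psi .$$ *Claim.* For every $j\ge1$, almost surely on $\{j\le N(d_a)\}$, $\mathcal P_C(T,j\mid d_a)$ is the conditional probability given $d_a$ that the typical user lies in $\mathcal C_j$ and has SINR at least $T$. The overall SINR coverage probability $\bar{\mathcal P}_C(T,\theta_k,\theta_U)$, that is, the probability that the typical user has SINR at least $T$, is $$\bar{\mathcal P}_C(T,\theta_k,\theta_U)=\mathbb E_{d_a}\Big[\sum_{j=1}^{N(d_a)}\mathcal P_C(T,j\mid d_a)\Big]=\int_0^\infty\Big(\sum_{j=1}^{N(y)}\mathcal P_C(T,j\mid y)\Big)\,2\lambda e^{-2\lambda y}\,dy ,$$ where the last integrand is integrable. All parameters $\lambda,K,P_t,N_0,B,\alpha_L,\alpha_N,d_S,G_0$ are positive. -/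

import Mathlib

open MeasureTheory ProbabilityTheory
open scoped ENNReal NNReal

namespace MmWave

/-- The system parameters.  `θ` is the common width of the base-station beams and `θU` the width of
the user beam.  `varDist x` is the variance of the distance-estimation error of a user at distance
`x`; `varAngle x ψ` is the variance of the angle-of-arrival estimation error of a user at
distance `x` with angle of arrival `ψ`. -/
structure Params where
  /-- linear density of the base stations -/
  lam : ℝ
  /-- base-station height -/
  h : ℝ
  /-- transmit power -/
  Pt : ℝ
  /-- path-loss coefficient -/
  K : ℝ
  /-- LOS path-loss exponent -/
  αL : ℝ
  /-- NLOS path-loss exponent -/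
  αN : ℝ
  /-- LOS Nakagami parameter -/
  NL : ℕ
  /-- NLOS Nakagami parameter -/
  NN : ℕ
  /-- noise power density -/
  N0 : ℝ
  /-- bandwidth -/
  B : ℝ
  /-- radius of the LOS ball -/
  dS : ℝ
  /-- gain of the equivalent omnidirectional antenna -/
  G0 : ℝ
  /-- side-lobe constant -/
  ε : ℝ
  /-- misalignment threshold for the pair of widths `θ`, `θU` -/
  ν : ℝ
  θ : ℝ
  θU : ℝ
  varDist : ℝ → ℝ≥0
  varAngle : ℝ → ℝ → ℝ≥0
  lam_pos : 0 < lam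
  h_pos : 0 < h
  Pt_pos : 0 < Pt
  K_pos : 0 < K
  αL_pos : 0 < αL
  αN_pos : 0 < αN
  NL_pos : 0 < NL
  NN_pos : 0 < NN
  N0_pos : 0 < N0
  B_pos : 0 < B
  dS_pos : 0 < dS
  G0_pos : 0 < G0
  ε_pos : 0 < ε
  ε_lt_one : ε < 1
  ν_pos : 0 < ν
  θ_pos : 0 < θ
  θ_lt : θ < Real.pi / 2
  θU_pos : 0 < θU
  θU_le : θU ≤ 2 * Real.pi
  measurable_varDist : Measurable varDist
  measurable_varAngle : Measurable (fun p : ℝ × ℝ => varAngle p.1 p.2)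

/-- The points of the sequence `X` form a homogeneous Poisson point process on `ℝ` of intensity
`lam`: counts of sets of finite length are Poisson, counts of disjoint sets are independent. -/
structure IsPoissonProcess {Ω : Type*} [MeasurableSpace Ω] (μ : Measure Ω) (lam : ℝ)
    (X : ℕ → Ω → ℝ) : Prop where
  measurable : ∀ i, Measurable (X i)
  count_law : ∀ A : Set ℝ, MeasurableSet A → volume A < ∞ →
    μ.map (fun ω => {i | X i ω ∈ A}.encard) =
      (poissonMeasure (lam * volume.real A).toNNReal).map (fun n : ℕ => (n : ℕ∞))
  count_indep : ∀ (n : ℕ) (A : Fin n → Set ℝ), (∀ k, MeasurableSet (A k)) →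
    Pairwise (fun k l => Disjoint (A k) (A l)) →
    iIndepFun (fun k ω => {i | X i ω ∈ A k}.encard) μ

noncomputable section

/-- Density of the inter-base-station distance `d_a`. -/
def interBSDensity (lam y : ℝ) : ℝ := if 0 ≤ y then 2 * lam * Real.exp (-(2 * lam * y)) else 0

/-- Density at `x` of the user distance given `d_a = y`: uniform on `[0, y]`. -/
def userDensity (y x : ℝ) : ℝ := if 0 ≤ x ∧ x ≤ y then y⁻¹ else 0

/-- Density of the angle of arrival: uniform on `[0, 2π]`. -/
def angleDensity (ψ : ℝ) : ℝ := if 0 ≤ ψ ∧ ψ ≤ 2 * Real.pi then (2 * Real.pi)⁻¹ else 0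

namespace Params

variable (P : Params)

/-- Main-lobe gain of a sectorized antenna of beamwidth `w`. -/
def mainGain (w : ℝ) : ℝ := P.G0 * ((2 * Real.pi - (2 * Real.pi - w) * P.ε) / w)

/-- Side-lobe gain. -/
def sideGain : ℝ := P.G0 * P.ε

/-- Path loss of a link of horizontal length `r`, LOS exactly when `r ≤ dS`. -/
def pathLoss (r : ℝ) : ℝ :=
  P.K * (r ^ 2 + P.h ^ 2) ^ (-(if r ≤ P.dS then P.αL else P.αN) / 2)

/-- Number of beams of width `θ` needed for a cell of length `y`. -/
def numBeams (y : ℝ) : ℕ := ⌈Real.arctan (y / P.h) / P.θ⌉₊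

/-- Left boundary of the ground coverage of the `j`-th beam. -/
def beamLeft (j : ℕ) : ℝ := P.h * Real.tan (((j : ℝ) - 1) * P.θ)

/-- Right boundary of the ground coverage of the `j`-th beam; it is infinite if the outer edge of
the beam points at or above the horizon. -/
def beamRight (j : ℕ) : EReal :=
  if (j : ℝ) * P.θ < Real.pi / 2 then ((P.h * Real.tan ((j : ℝ) * P.θ) : ℝ) : EReal) else ⊤

/-- Ground coverage of the `j`-th beam. -/
def beamCell (j : ℕ) : Set ℝ := {x | P.beamLeft j ≤ x ∧ (x : EReal) ≤ P.beamRight j}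

/-- Index of the beam in whose coverage a user at distance `x` lies. -/
def beamIndex (x : ℝ) : ℕ := ⌈Real.arctan (x / P.h) / P.θ⌉₊

/-- Beam-selection error probability: the estimated distance of a user at distance `x`, which is
normal with mean `x` and variance `varDist x`, falls outside the `j`-th beam. -/
def beamError (j : ℕ) (x : ℝ) : ℝ := (gaussianReal x (P.varDist x)).real {e | e ∉ P.beamCell j}

/-- Misalignment probability: the estimated angle of arrival, which is normal with mean `ψ` and
variance `varAngle x ψ`, is off by at least `ν`. -/
def misalignment (x ψ : ℝ) : ℝ := (gaussianReal ψ (P.varAngle x ψ)).real {e | P.ν ≤ |ψ - e|}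

end Params

/-- The random objects of the network on a probability space.  Positions are horizontal and
relative to the typical user.  Index `0` of the two fading sequences belongs to the serving link and
index `i + 1` to the link to the point `X i`. -/
structure Model (P : Params) {Ω : Type*} [MeasurableSpace Ω] (μ : Measure Ω) where
  /-- inter-base-station distance -/
  da : Ω → ℝ
  /-- distance from the user to its serving base station -/
  d : Ω → ℝ
  /-- angle of arrival -/
  ψ : Ω → ℝ
  /-- normalized distance-estimation error -/
  Zd : Ω → ℝ
  /-- normalized angle-estimation error -/
  Zψ : Ω → ℝ
  /-- Poisson process of base stations -/
  X : ℕ → Ω → ℝ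
  /-- LOS fading powers -/
  FL : ℕ → Ω → ℝ
  /-- NLOS fading powers -/
  FN : ℕ → Ω → ℝ
  measurable_da : Measurable da
  measurable_d : Measurable d
  measurable_ψ : Measurable ψ
  measurable_Zd : Measurable Zd
  measurable_Zψ : Measurable Zψ
  measurable_FL : ∀ i, Measurable (FL i)
  measurable_FN : ∀ i, Measurable (FN i)
  law_da_d : μ.map (fun ω => (da ω, d ω)) = (volume : Measure (ℝ × ℝ)).withDensity
    (fun p => ENNReal.ofReal (userDensity p.1 p.2 * interBSDensity P.lam p.1))
  law_ψ : μ.map ψ = (volume : Measure ℝ).withDensity (fun a => ENNReal.ofReal (angleDensity a))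
  law_Zd : μ.map Zd = gaussianReal 0 1
  law_Zψ : μ.map Zψ = gaussianReal 0 1
  poisson : IsPoissonProcess μ P.lam X
  /-- the squared modulus of a unit-power Nakagami variable of parameter `m` is Gamma with shape
  and rate `m` -/
  law_FL : ∀ i, μ.map (FL i) = gammaMeasure P.NL P.NL
  law_FN : ∀ i, μ.map (FN i) = gammaMeasure P.NN P.NN
  indep_FL : iIndepFun FL μ
  indep_FN : iIndepFun FN μ
  /-- `(da, d)`, `ψ`, `Zd`, `Zψ`, `X`, `FL`, `FN` are mutually independent -/
  indep : μ.map (fun ω => ((da ω, d ω), ψ ω, Zd ω, Zψ ω,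
      (fun i => X i ω), (fun i => FL i ω), (fun i => FN i ω))) =
    (μ.map (fun ω => (da ω, d ω))).prod ((μ.map ψ).prod ((μ.map Zd).prod ((μ.map Zψ).prod
      ((μ.map (fun ω i => X i ω)).prod
        ((μ.map (fun ω i => FL i ω)).prod (μ.map (fun ω i => FN i ω)))))))

namespace Model

variable {P : Params} {Ω : Type*} [MeasurableSpace Ω] {μ : Measure Ω} (M : Model P μ)

/-- Fading power on the link of number `i` if that link has horizontal length `r`. -/
def fading (i : ℕ) (r : ℝ) (ω : Ω) : ℝ := if r ≤ P.dS then M.FL i ω else M.FN i ω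

/-- Total interference power at a user served from distance `x`: the interferers are the base
stations that are farther away than the serving one, all received through side lobes. -/
def interference (x : ℝ) (ω : Ω) : ℝ≥0∞ :=
  ∑' i, if x < |M.X i ω| then
    ENNReal.ofReal (P.Pt * M.fading (i + 1) |M.X i ω| ω * P.sideGain ^ 2 * P.pathLoss |M.X i ω|)
  else 0

/-- SINR of a user served from distance `x` with base-station gain `GB` and user gain `GU`. -/
def sinr (x GB GU : ℝ) (ω : Ω) : ℝ≥0∞ :=
  ENNReal.ofReal (P.Pt * M.fading 0 x ω * GB * GU * P.pathLoss x) /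
    (ENNReal.ofReal (P.N0 * P.B) + M.interference x ω)

/-- Estimated distance: normal with mean `d` and variance `varDist d` given `d`. -/
def dHat (ω : Ω) : ℝ := M.d ω + Real.sqrt (P.varDist (M.d ω)) * M.Zd ω

/-- Estimated angle of arrival: normal with mean `ψ` and variance `varAngle d ψ` given `d, ψ`. -/
def ψHat (ω : Ω) : ℝ := M.ψ ω + Real.sqrt (P.varAngle (M.d ω) (M.ψ ω)) * M.Zψ ω

open Classical in
/-- SINR of the typical user: both gains are side-lobe gains after a beam-selection error; without
such an error the base-station gain is the main-lobe gain, and so is the user gain unless the beams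
are misaligned. -/
def userSINR (ω : Ω) : ℝ≥0∞ :=
  if M.dHat ω ∉ P.beamCell (P.beamIndex (M.d ω)) then
    M.sinr (M.d ω) P.sideGain P.sideGain ω
  else if P.ν ≤ |M.ψ ω - M.ψHat ω| then
    M.sinr (M.d ω) (P.mainGain P.θ) P.sideGain ω
  else
    M.sinr (M.d ω) (P.mainGain P.θ) (P.mainGain P.θU) ω

/-- Overall SINR coverage probability at threshold `T`. -/
def overallCoverage (T : ℝ) : ℝ := μ.real {ω | ENNReal.ofReal T ≤ M.userSINR ω}

/-- SINR coverage probability of a user at the fixed distance `x` with fixed gains. -/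
def coverageAt (T x GB GU : ℝ) : ℝ := μ.real {ω | ENNReal.ofReal T ≤ M.sinr x GB GU ω}

/-- No beam-selection error and no misalignment. -/
def T0 (T x : ℝ) : ℝ := M.coverageAt T x (P.mainGain P.θ) (P.mainGain P.θU)

/-- No beam-selection error, but misalignment. -/
def TMA (T x : ℝ) : ℝ := M.coverageAt T x (P.mainGain P.θ) P.sideGain

/-- Beam-selection error. -/
def TBS (T x : ℝ) : ℝ := M.coverageAt T x P.sideGain P.sideGain

/-- Coverage probability through the `j`-th beam in a cell of length `y`. -/
def beamCoverage (T y : ℝ) (j : ℕ) : ℝ :=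
  ∫ ψ in (0 : ℝ)..(2 * Real.pi), ∫ x in P.beamCell j,
    (P.beamError j x * M.TBS T x +
      (1 - P.beamError j x) *
        ((1 - P.misalignment x ψ) * M.T0 T x + P.misalignment x ψ * M.TMA T x)) *
      userDensity y x * angleDensity ψ

end Model

end

end MmWave

namespace MmWave

/-! ### Densities -/

/-! The result is the law of total probability over the position and the beam, in a form that also
yields the conditional statement. Writing both estimation errors as scaled standard normals and the
SINR as a function `envSINR` of the distance and of the environment (interferers and fading) makes
`(da, d)`, `ψ`, `Zd`, `Zψ` and the environment independent. Once `d` and `ψ` are frozen and the beam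
index is fixed, the event "SINR at least `T`" is a decision tree in independent variables, and its
probability is the bracket in the definition of `beamCoverage` (`measure_beamEvent`).

Tonelli over the law of `(da, d)` and `ψ` then gives the probability of `coveredBy` on each event
`da ∈ A` as the integral over `A` of `beamCoverage` against the density of `da`
(`measure_coveredBy_inter_eq_setLIntegral`). Arbitrary `A` identifies the conditional probability
given `da` (`condExp_coveredBy`); `A = univ` gives the total probability of each beam.

Two null sets complete the argument. Neighbouring closed cells share only boundary points, which `d`
almost surely avoids, so the beams split the coverage event (`overallCoverage_eq_sum`). A beam with
index above `numBeams y` meets `[0, y]` in at most one point, so the sum may run up to the fixed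
number `maxBeams` (`sum_beamCoverage_eq`), and integral and finite sum commute. -/

theorem measurable_interBSDensity (lam : ℝ) : Measurable (interBSDensity lam) := by
  unfold interBSDensity
  exact Measurable.ite measurableSet_Ici (by fun_prop) measurable_const

theorem measurable_userDensity : Measurable (fun p : ℝ × ℝ => userDensity p.1 p.2) := by
  unfold userDensity
  refine Measurable.ite ?_ (by fun_prop) measurable_const
  exact (measurableSet_le measurable_const measurable_snd).inter
    (measurableSet_le measurable_snd measurable_fst)

theorem measurable_angleDensity : Measurable angleDensity := by
  unfold angleDensity
  exact Measurable.ite measurableSet_Icc measurable_const measurable_const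

theorem interBSDensity_nonneg {lam : ℝ} (hl : 0 < lam) (y : ℝ) : 0 ≤ interBSDensity lam y := by
  unfold interBSDensity
  split_ifs <;> positivity

theorem userDensity_nonneg (y x : ℝ) : 0 ≤ userDensity y x := by
  unfold userDensity
  split_ifs with h
  · exact inv_nonneg.2 (h.1.trans h.2)
  · exact le_rfl

theorem angleDensity_nonneg (ψ : ℝ) : 0 ≤ angleDensity ψ := by
  unfold angleDensity
  split_ifs <;> positivity

theorem lintegral_userDensity {y : ℝ} (hy : 0 < y) :
    ∫⁻ x, ENNReal.ofReal (userDensity y x) = 1 := by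
  have h : (fun x => ENNReal.ofReal (userDensity y x)) =
      (Set.Icc 0 y).indicator (fun _ => ENNReal.ofReal y⁻¹) := by
    ext x
    by_cases hx : 0 ≤ x ∧ x ≤ y <;> simp [userDensity, Set.indicator, hx]
  rw [h, lintegral_indicator measurableSet_Icc, setLIntegral_const, Real.volume_Icc, sub_zero,
    ← ENNReal.ofReal_mul (by positivity), inv_mul_cancel₀ hy.ne', ENNReal.ofReal_one]

theorem userDensity_of_nonpos {y : ℝ} (hy : y ≤ 0) (x : ℝ) : userDensity y x = 0 := by
  unfold userDensity
  split_ifs with h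
  -- Only `y = 0` is left here, where the convention `0⁻¹ = 0` makes the density vanish.
  · rw [le_antisymm hy (h.1.trans h.2), inv_zero]
  · rfl

theorem lintegral_userDensity_ne_top (y : ℝ) :
    ∫⁻ x, ENNReal.ofReal (userDensity y x) ≠ ∞ := by
  rcases lt_or_ge 0 y with hy | hy
  · simp [lintegral_userDensity hy]
  · simp [userDensity_of_nonpos hy]

theorem lintegral_law_da_d (lam : ℝ) {f : ℝ × ℝ → ℝ≥0∞} (hf : Measurable f) :
    ∫⁻ p, f p ∂((volume : Measure (ℝ × ℝ)).withDensity
      (fun p => ENNReal.ofReal (userDensity p.1 p.2 * interBSDensity lam p.1))) =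
    ∫⁻ y, ENNReal.ofReal (interBSDensity lam y) *
      ∫⁻ x, ENNReal.ofReal (userDensity y x) * f (y, x) := by
  have hm : Measurable fun p : ℝ × ℝ =>
      ENNReal.ofReal (userDensity p.1 p.2 * interBSDensity lam p.1) :=
    (measurable_userDensity.mul ((measurable_interBSDensity lam).comp measurable_fst)).ennreal_ofReal
  rw [lintegral_withDensity_eq_lintegral_mul _ hm hf, Measure.volume_eq_prod,
    lintegral_prod _ (hm.mul hf).aemeasurable]
  refine lintegral_congr fun y => ?_
  have hu : Measurable (userDensity y) := measurable_userDensity.comp measurable_prodMk_left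
  have hfy : Measurable fun x => f (y, x) := hf.comp measurable_prodMk_left
  rw [← lintegral_const_mul _ (by fun_prop)]
  refine lintegral_congr fun x => ?_
  rw [Pi.mul_apply, ENNReal.ofReal_mul (userDensity_nonneg y x)]
  ring

/-! ### Beam geometry -/

namespace Params

variable (P : Params)

theorem mem_beamCell {j : ℕ} {x : ℝ} : x ∈ P.beamCell j ↔
    P.beamLeft j ≤ x ∧ (x : EReal) ≤ P.beamRight j := Iff.rfl

theorem measurableSet_beamCell (j : ℕ) : MeasurableSet (P.beamCell j) :=
  (measurableSet_le measurable_const measurable_id).inter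
    (measurableSet_le measurable_coe_real_ereal measurable_const)

theorem lt_arctan_iff {a x : ℝ} (h0 : -(Real.pi / 2) < a) (h1 : a < Real.pi / 2) :
    a < Real.arctan (x / P.h) ↔ P.h * Real.tan a < x := by
  conv_lhs => rw [← Real.arctan_tan h0 h1]
  rw [Real.arctan_lt_arctan_iff, lt_div_iff₀ P.h_pos, mul_comm]

theorem index_mul_nonneg {j : ℕ} (hj : 1 ≤ j) : 0 ≤ ((j : ℝ) - 1) * P.θ :=
  mul_nonneg (sub_nonneg.2 (by exact_mod_cast hj)) P.θ_pos.le

/-- The inner edge must point below the horizon: `tan` inverts `arctan` only on its principal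
branch. -/
theorem beamLeft_lt_iff {j : ℕ} {x : ℝ} (hj : 1 ≤ j) (hjπ : ((j : ℝ) - 1) * P.θ < Real.pi / 2) :
    P.beamLeft j < x ↔ (j : ℝ) - 1 < Real.arctan (x / P.h) / P.θ := by
  rw [beamLeft, ← P.lt_arctan_iff (by linarith [P.index_mul_nonneg hj, Real.pi_pos]) hjπ,
    lt_div_iff₀ P.θ_pos]

/-- No bound on `j` is needed, because past the horizon the edge is infinite and `arctan` stays
below `π / 2`, so both sides hold. -/
theorem le_beamRight_iff {j : ℕ} {x : ℝ} :
    (x : EReal) ≤ P.beamRight j ↔ Real.arctan (x / P.h) / P.θ ≤ j := by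
  rw [beamRight, div_le_iff₀ P.θ_pos]
  split_ifs with h
  · rw [EReal.coe_le_coe_iff, ← not_lt, ← P.lt_arctan_iff _ h, not_lt]
    have : 0 ≤ (j : ℝ) * P.θ := mul_nonneg j.cast_nonneg P.θ_pos.le
    linarith [Real.pi_pos]
  · simp only [le_top, true_iff]
    exact (Real.arctan_lt_pi_div_two _).le.trans (not_lt.1 h)

theorem beamIndex_eq_iff {j : ℕ} {x : ℝ} (hj : 1 ≤ j) (hjπ : ((j : ℝ) - 1) * P.θ < Real.pi / 2) :
    P.beamIndex x = j ↔ P.beamLeft j < x ∧ (x : EReal) ≤ P.beamRight j := by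
  rw [beamIndex, Nat.ceil_eq_iff (by lia), P.beamLeft_lt_iff hj hjπ, le_beamRight_iff,
    Nat.cast_pred hj]

/-- The ceiling in `beamIndex` produces cells open on the left, whereas `beamCell` is closed; the
left endpoint is the only discrepancy. -/
theorem mem_beamCell_iff_beamIndex_eq {j : ℕ} {x : ℝ} (hj : 1 ≤ j)
    (hjπ : ((j : ℝ) - 1) * P.θ < Real.pi / 2) (hne : x ≠ P.beamLeft j) :
    x ∈ P.beamCell j ↔ P.beamIndex x = j := by
  rw [P.beamIndex_eq_iff hj hjπ, mem_beamCell, hne.symm.le_iff_lt]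

theorem beamIndex_pos {x : ℝ} (hx : 0 < x) : 1 ≤ P.beamIndex x :=
  Nat.ceil_pos.2 (div_pos (Real.arctan_pos.2 (div_pos hx P.h_pos)) P.θ_pos)

/-- Number of beams of width `θ` from nadir to the horizon. -/
noncomputable def maxBeams : ℕ := ⌈Real.pi / 2 / P.θ⌉₊

theorem numBeams_le_maxBeams (y : ℝ) : P.numBeams y ≤ P.maxBeams :=
  Nat.ceil_le_ceil (div_le_div_of_nonneg_right (Real.arctan_lt_pi_div_two _).le P.θ_pos.le)

theorem lt_pi_div_two_of_le_maxBeams {j : ℕ} (hj : 1 ≤ j) (h : j ≤ P.maxBeams) :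
    ((j : ℝ) - 1) * P.θ < Real.pi / 2 := by
  have : j - 1 < ⌈Real.pi / 2 / P.θ⌉₊ := lt_of_lt_of_le (by lia) h
  rwa [Nat.lt_ceil, Nat.cast_pred hj, lt_div_iff₀ P.θ_pos] at this

theorem beamIndex_le_maxBeams (x : ℝ) : P.beamIndex x ≤ P.maxBeams := P.numBeams_le_maxBeams x

theorem le_beamLeft_of_numBeams_lt {j : ℕ} {y : ℝ} (hj : 1 ≤ j) (hJ : j ≤ P.maxBeams)
    (h : P.numBeams y < j) : y ≤ P.beamLeft j := by
  rw [← not_lt, P.beamLeft_lt_iff hj (P.lt_pi_div_two_of_le_maxBeams hj hJ), not_lt,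
    ← Nat.cast_pred hj]
  exact Nat.ceil_le.1 (Nat.le_sub_one_of_lt h)

/-! ### Error probabilities -/

/-- Moves the dependence on mean and variance from the measure into the event. The error
probabilities become section measures under one fixed law, hence measurable in the position, and
match the normalized errors `Zd` and `Zψ`. Variance zero is covered. -/
theorem _root_.MmWave.gaussianReal_real_preimage (m : ℝ) (v : ℝ≥0) {S : Set ℝ}
    (hS : MeasurableSet S) :
    (gaussianReal 0 1).real ((fun z => m + Real.sqrt v * z) ⁻¹' S) = (gaussianReal m v).real S := by
  have h : (gaussianReal 0 1).map (fun z => m + Real.sqrt v * z) = gaussianReal m v := by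
    rw [show (fun z => m + Real.sqrt v * z) = (fun x => m + x) ∘ fun z => Real.sqrt v * z from rfl,
      ← Measure.map_map (by fun_prop) (by fun_prop), gaussianReal_map_const_mul,
      gaussianReal_map_const_add]
    congr 1
    · simp
    · ext
      simp
  rw [← h, map_measureReal_apply (by fun_prop) hS]

theorem beamError_eq (j : ℕ) (x : ℝ) : P.beamError j x =
    (gaussianReal 0 1).real {z | x + Real.sqrt (P.varDist x) * z ∉ P.beamCell j} :=
  (gaussianReal_real_preimage x (P.varDist x) (P.measurableSet_beamCell j).compl).symm

theorem misalignment_eq (x ψ : ℝ) : P.misalignment x ψ = (gaussianReal 0 1).real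
    {z | P.ν ≤ |ψ - (ψ + Real.sqrt (P.varAngle x ψ) * z)|} :=
  (gaussianReal_real_preimage ψ (P.varAngle x ψ)
    (measurableSet_le measurable_const (by fun_prop))).symm

theorem measurableSet_beamErrorEvent (j : ℕ) : MeasurableSet
    {p : ℝ × ℝ | p.1 + Real.sqrt (P.varDist p.1) * p.2 ∉ P.beamCell j} := by
  have := P.measurable_varDist
  exact (show Measurable fun p : ℝ × ℝ => p.1 + Real.sqrt (P.varDist p.1) * p.2 by fun_prop)
    (P.measurableSet_beamCell j).compl

theorem measurableSet_misalignmentEvent : MeasurableSet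
    {p : (ℝ × ℝ) × ℝ | P.ν ≤ |p.1.2 - (p.1.2 + Real.sqrt (P.varAngle p.1.1 p.1.2) * p.2)|} := by
  have : Measurable fun p : (ℝ × ℝ) × ℝ => P.varAngle p.1.1 p.1.2 :=
    P.measurable_varAngle.comp measurable_fst
  exact measurableSet_le measurable_const (by fun_prop)

theorem measurable_beamError (j : ℕ) : Measurable (P.beamError j) := by
  simp_rw [funext (P.beamError_eq j)]
  exact (measurable_measure_prodMk_left (P.measurableSet_beamErrorEvent j)).ennreal_toReal

theorem measurable_misalignment : Measurable fun p : ℝ × ℝ => P.misalignment p.1 p.2 := by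
  simp_rw [misalignment_eq]
  exact (measurable_measure_prodMk_left P.measurableSet_misalignmentEvent).ennreal_toReal

theorem measurable_pathLoss : Measurable P.pathLoss := by
  unfold pathLoss
  have : Measurable fun r : ℝ => if r ≤ P.dS then P.αL else P.αN :=
    Measurable.ite measurableSet_Iic measurable_const measurable_const
  fun_prop

/-! ### The SINR as a function of the environment -/

/-- Fading power on the link of number `i` and length `r` in the environment `w`, which consists of
the other base stations, the LOS and the NLOS fading powers. -/
noncomputable def envFading (i : ℕ) (r : ℝ) (w : (ℕ → ℝ) × (ℕ → ℝ) × (ℕ → ℝ)) : ℝ :=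
  if r ≤ P.dS then w.2.1 i else w.2.2 i

/-- SINR at distance `x` with gains `GB`, `GU` in the environment `w`. -/
noncomputable def envSINR (x GB GU : ℝ) (w : (ℕ → ℝ) × (ℕ → ℝ) × (ℕ → ℝ)) : ℝ≥0∞ :=
  ENNReal.ofReal (P.Pt * P.envFading 0 x w * GB * GU * P.pathLoss x) /
    (ENNReal.ofReal (P.N0 * P.B) + ∑' i, if x < |w.1 i| then
      ENNReal.ofReal
        (P.Pt * P.envFading (i + 1) |w.1 i| w * P.sideGain ^ 2 * P.pathLoss |w.1 i|)
      else 0)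

theorem measurable_envFading (i : ℕ) : Measurable
    fun p : ℝ × (ℕ → ℝ) × (ℕ → ℝ) × (ℕ → ℝ) => P.envFading i p.1 p.2 := by
  unfold envFading
  exact Measurable.ite (measurableSet_le measurable_fst measurable_const)
    (by fun_prop) (by fun_prop)

theorem measurable_envSINR (GB GU : ℝ) : Measurable
    fun p : ℝ × (ℕ → ℝ) × (ℕ → ℝ) × (ℕ → ℝ) => P.envSINR p.1 GB GU p.2 := by
  have hp := P.measurable_pathLoss
  have h0 := P.measurable_envFading 0
  unfold envSINR
  refine Measurable.div (by fun_prop)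
    (Measurable.fun_add measurable_const (Measurable.tsum fun i => ?_))
  have hX : Measurable fun p : ℝ × (ℕ → ℝ) × (ℕ → ℝ) × (ℕ → ℝ) => |p.2.1 i| := by fun_prop
  have h1 : Measurable fun p : ℝ × (ℕ → ℝ) × (ℕ → ℝ) × (ℕ → ℝ) =>
      P.envFading (i + 1) |p.2.1 i| p.2 :=
    (P.measurable_envFading (i + 1)).comp (hX.prodMk measurable_snd)
  exact Measurable.ite (measurableSet_lt measurable_fst hX) (by fun_prop) measurable_const

theorem measurableSet_le_envSINR {δ : Type*} [MeasurableSpace δ] {f : δ → ℝ}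
    {g : δ → (ℕ → ℝ) × (ℕ → ℝ) × (ℕ → ℝ)} (hf : Measurable f) (hg : Measurable g) (t : ℝ≥0∞)
    (GB GU : ℝ) : MeasurableSet {q | t ≤ P.envSINR (f q) GB GU (g q)} := by
  have h : MeasurableSet {p : ℝ × (ℕ → ℝ) × (ℕ → ℝ) × (ℕ → ℝ) | t ≤ P.envSINR p.1 GB GU p.2} :=
    measurableSet_le measurable_const (P.measurable_envSINR GB GU)
  exact (hf.prodMk hg) h

end Params

/-- The measure of a set of triples described by a decision tree in the first two coordinates. -/
theorem prod_real_ite {α β γ : Type*} [MeasurableSpace α] [MeasurableSpace β] [MeasurableSpace γ]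
    (μ : Measure α) (ν : Measure β) (κ : Measure γ) [IsProbabilityMeasure μ]
    [IsProbabilityMeasure ν] [IsProbabilityMeasure κ] {A : Set α} {B : Set β} {S₁ S₂ S₃ : Set γ}
    (hA : MeasurableSet A) (hB : MeasurableSet B) (h₂ : MeasurableSet S₂)
    (h₃ : MeasurableSet S₃) :
    (μ.prod (ν.prod κ)).real {p | (p.1 ∈ A ∧ p.2.2 ∈ S₁) ∨
      (p.1 ∉ A ∧ p.2.1 ∈ B ∧ p.2.2 ∈ S₂) ∨ (p.1 ∉ A ∧ p.2.1 ∉ B ∧ p.2.2 ∈ S₃)} =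
    μ.real A * κ.real S₁ +
      (1 - μ.real A) * ((1 - ν.real B) * κ.real S₃ + ν.real B * κ.real S₂) := by
  have h : {p : α × β × γ | (p.1 ∈ A ∧ p.2.2 ∈ S₁) ∨
      (p.1 ∉ A ∧ p.2.1 ∈ B ∧ p.2.2 ∈ S₂) ∨ (p.1 ∉ A ∧ p.2.1 ∉ B ∧ p.2.2 ∈ S₃)} =
      (A ×ˢ (Set.univ ×ˢ S₁)) ∪ ((Aᶜ ×ˢ (B ×ˢ S₂)) ∪ (Aᶜ ×ˢ (Bᶜ ×ˢ S₃))) := by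
    ext p
    simp
  -- Additivity asks measurability of the second set of each union only, so `S₁` may be arbitrary.
  rw [h, measureReal_union _ ((hA.compl.prod (hB.prod h₂)).union (hA.compl.prod (hB.compl.prod h₃))),
    measureReal_union _ (hA.compl.prod (hB.compl.prod h₃))]
  · simp only [measureReal_prod_prod, probReal_compl_eq_one_sub hA, probReal_compl_eq_one_sub hB,
      probReal_univ]
    ring
  · rw [Set.disjoint_left]
    simp +contextual
  · rw [Set.disjoint_left]
    simp +contextual

/-! ### Joint law and coverage at a fixed position and angle of arrival -/

namespace Model

variable {P : Params} {Ω : Type*} [MeasurableSpace Ω] {μ : Measure Ω} (M : Model P μ)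

/-- The positions of the other base stations and all fading powers. -/
def env (ω : Ω) : (ℕ → ℝ) × (ℕ → ℝ) × (ℕ → ℝ) :=
  (fun i => M.X i ω, fun i => M.FL i ω, fun i => M.FN i ω)

theorem measurable_env : Measurable M.env :=
  (measurable_pi_lambda _ M.poisson.measurable).prodMk
    ((measurable_pi_lambda _ M.measurable_FL).prodMk (measurable_pi_lambda _ M.measurable_FN))

theorem sinr_eq (x GB GU : ℝ) (ω : Ω) : M.sinr x GB GU ω = P.envSINR x GB GU (M.env ω) := rfl

theorem coverageAt_eq (T x GB GU : ℝ) : M.coverageAt T x GB GU =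
    (μ.map M.env).real {w | ENNReal.ofReal T ≤ P.envSINR x GB GU w} := by
  rw [map_measureReal_apply M.measurable_env 
    (P.measurableSet_le_envSINR measurable_const measurable_id' _ _ _)]
  rfl

theorem indep_env [IsProbabilityMeasure μ] :
    μ.map (fun ω => ((M.da ω, M.d ω), M.ψ ω, M.Zd ω, M.Zψ ω, M.env ω)) =
    (μ.map (fun ω => (M.da ω, M.d ω))).prod ((μ.map M.ψ).prod
      ((gaussianReal 0 1).prod ((gaussianReal 0 1).prod (μ.map M.env)))) := by
  have hd : Measurable fun ω => (M.da ω, M.d ω) := M.measurable_da.prodMk M.measurable_d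
  have hX : Measurable fun ω i => M.X i ω := measurable_pi_lambda _ M.poisson.measurable
  have hL : Measurable fun ω i => M.FL i ω := measurable_pi_lambda _ M.measurable_FL
  have hN : Measurable fun ω i => M.FN i ω := measurable_pi_lambda _ M.measurable_FN
  have := Measure.isProbabilityMeasure_map (μ := μ) hd.aemeasurable
  have := Measure.isProbabilityMeasure_map (μ := μ) M.measurable_ψ.aemeasurable
  have := Measure.isProbabilityMeasure_map (μ := μ) M.measurable_Zd.aemeasurable
  have := Measure.isProbabilityMeasure_map (μ := μ) M.measurable_Zψ.aemeasurable
  have := Measure.isProbabilityMeasure_map (μ := μ) hX.aemeasurable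
  have := Measure.isProbabilityMeasure_map (μ := μ) hL.aemeasurable
  have := Measure.isProbabilityMeasure_map (μ := μ) hN.aemeasurable
  have henv : μ.map M.env = (μ.map (fun ω i => M.X i ω)).prod
      ((μ.map (fun ω i => M.FL i ω)).prod (μ.map (fun ω i => M.FN i ω))) := by
    -- The law of the environment is a marginal of the full product law, so it is itself the product
    -- of its three factors.
    have h := congrArg (Measure.map fun p => p.2.2.2.2) M.indep
    rw [Measure.map_map (by fun_prop) (hd.prodMk (M.measurable_ψ.prodMk (M.measurable_Zd.prodMk
      (M.measurable_Zψ.prodMk (hX.prodMk (hL.prodMk hN))))))] at h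
    refine Eq.trans h ?_
    change Measure.map (Prod.snd ∘ Prod.snd ∘ Prod.snd ∘ Prod.snd) _ = _
    rw [← Measure.map_map (by fun_prop) (by fun_prop), ← Measure.map_map (by fun_prop) (by fun_prop),
      ← Measure.map_map (by fun_prop) (by fun_prop)]
    simp only [Measure.map_snd_prod, measure_univ, one_smul]
  rw [henv]
  have h := M.indep
  rw [M.law_Zd, M.law_Zψ] at h
  exact h

theorem measurable_coverageAt [IsProbabilityMeasure μ] (T GB GU : ℝ) :
    Measurable fun x => M.coverageAt T x GB GU := by
  have := Measure.isProbabilityMeasure_map (μ := μ) M.measurable_env.aemeasurable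
  simp_rw [coverageAt_eq]
  exact (measurable_measure_prodMk_left
    (measurableSet_le measurable_const (P.measurable_envSINR GB GU))).ennreal_toReal

/-- Coverage probability of a user at distance `x` with angle of arrival `ψ` who is served through
the `j`-th beam. -/
noncomputable def beamCoverageAt (T : ℝ) (j : ℕ) (x ψ : ℝ) : ℝ :=
  P.beamError j x * M.TBS T x +
    (1 - P.beamError j x) *
      ((1 - P.misalignment x ψ) * M.T0 T x + P.misalignment x ψ * M.TMA T x)

theorem measurable_beamCoverageAt [IsProbabilityMeasure μ] (T : ℝ) (j : ℕ) :
    Measurable fun p : ℝ × ℝ => M.beamCoverageAt T j p.1 p.2 := by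
  have h1 := P.measurable_beamError j
  have h2 := P.measurable_misalignment
  have h3 := M.measurable_coverageAt T (P.mainGain P.θ) (P.mainGain P.θU)
  have h4 := M.measurable_coverageAt T (P.mainGain P.θ) P.sideGain
  have h5 := M.measurable_coverageAt T P.sideGain P.sideGain
  unfold beamCoverageAt TBS T0 TMA
  fun_prop

/-- The event that the SINR is at least `T` for a user at distance `x` with angle of arrival `ψ` who
is served through the `j`-th beam, in terms of the errors and the environment. -/
def beamEvent (P : Params) (T : ℝ) (j : ℕ) (x ψ : ℝ) :
    Set (ℝ × ℝ × ((ℕ → ℝ) × (ℕ → ℝ) × (ℕ → ℝ))) :=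
  {p | (p.1 ∈ {z | x + Real.sqrt (P.varDist x) * z ∉ P.beamCell j} ∧
      p.2.2 ∈ {w | ENNReal.ofReal T ≤ P.envSINR x P.sideGain P.sideGain w}) ∨
    (p.1 ∉ {z | x + Real.sqrt (P.varDist x) * z ∉ P.beamCell j} ∧
      p.2.1 ∈ {z | P.ν ≤ |ψ - (ψ + Real.sqrt (P.varAngle x ψ) * z)|} ∧
      p.2.2 ∈ {w | ENNReal.ofReal T ≤ P.envSINR x (P.mainGain P.θ) P.sideGain w}) ∨
    (p.1 ∉ {z | x + Real.sqrt (P.varDist x) * z ∉ P.beamCell j} ∧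
      p.2.1 ∉ {z | P.ν ≤ |ψ - (ψ + Real.sqrt (P.varAngle x ψ) * z)|} ∧
      p.2.2 ∈ {w | ENNReal.ofReal T ≤ P.envSINR x (P.mainGain P.θ) (P.mainGain P.θU) w})}

theorem measure_beamEvent [IsProbabilityMeasure μ] (T : ℝ) (j : ℕ) (x ψ : ℝ) :
    ((gaussianReal 0 1).prod ((gaussianReal 0 1).prod (μ.map M.env))).real (beamEvent P T j x ψ) =
      M.beamCoverageAt T j x ψ := by
  have := Measure.isProbabilityMeasure_map (μ := μ) M.measurable_env.aemeasurable
  have hS : ∀ GB GU, MeasurableSet {w | ENNReal.ofReal T ≤ P.envSINR x GB GU w} := fun GB GU =>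
    P.measurableSet_le_envSINR measurable_const measurable_id' _ _ _
  have hA : MeasurableSet {z | x + Real.sqrt (P.varDist x) * z ∉ P.beamCell j} :=
    measurable_prodMk_left (P.measurableSet_beamErrorEvent j)
  have hB : MeasurableSet {z | P.ν ≤ |ψ - (ψ + Real.sqrt (P.varAngle x ψ) * z)|} :=
    measurable_prodMk_left (x := (x, ψ)) P.measurableSet_misalignmentEvent
  rw [beamEvent, prod_real_ite _ _ _ hA hB (hS _ _) (hS _ _), ← P.beamError_eq,
    ← P.misalignment_eq, ← coverageAt_eq, ← coverageAt_eq, ← coverageAt_eq]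
  rfl

/-- The value is the probability of `beamEvent`. These bounds supply the nonnegativity and
domination used in the integrals below. -/
theorem beamCoverageAt_mem_Icc [IsProbabilityMeasure μ] (T : ℝ) (j : ℕ) (x ψ : ℝ) :
    M.beamCoverageAt T j x ψ ∈ Set.Icc 0 1 := by
  have := Measure.isProbabilityMeasure_map (μ := μ) M.measurable_env.aemeasurable
  rw [← measure_beamEvent]
  exact ⟨measureReal_nonneg, measureReal_le_one⟩

theorem measurableSet_beamEvent (P : Params) (T : ℝ) (j : ℕ) : MeasurableSet
    {q : (ℝ × ℝ) × ℝ × ℝ × ℝ × ((ℕ → ℝ) × (ℕ → ℝ) × (ℕ → ℝ)) |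
      q.2.2 ∈ beamEvent P T j q.1.2 q.2.1} := by
  have hS : ∀ GB GU, MeasurableSet
      {q : (ℝ × ℝ) × ℝ × ℝ × ℝ × ((ℕ → ℝ) × (ℕ → ℝ) × (ℕ → ℝ)) |
        ENNReal.ofReal T ≤ P.envSINR q.1.2 GB GU q.2.2.2.2} := fun GB GU =>
    P.measurableSet_le_envSINR (by fun_prop) (by fun_prop) _ _ _
  have hB : MeasurableSet {q : (ℝ × ℝ) × ℝ × ℝ × ℝ × ((ℕ → ℝ) × (ℕ → ℝ) × (ℕ → ℝ)) |
      q.1.2 + Real.sqrt (P.varDist q.1.2) * q.2.2.1 ∉ P.beamCell j} :=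
    (show Measurable fun q : (ℝ × ℝ) × ℝ × ℝ × ℝ × ((ℕ → ℝ) × (ℕ → ℝ) × (ℕ → ℝ)) =>
        (q.1.2, q.2.2.1) by fun_prop) (P.measurableSet_beamErrorEvent j)
  have hA : MeasurableSet {q : (ℝ × ℝ) × ℝ × ℝ × ℝ × ((ℕ → ℝ) × (ℕ → ℝ) × (ℕ → ℝ)) |
      P.ν ≤ |q.2.1 - (q.2.1 + Real.sqrt (P.varAngle q.1.2 q.2.1) * q.2.2.2.1)|} :=
    (show Measurable fun q : (ℝ × ℝ) × ℝ × ℝ × ℝ × ((ℕ → ℝ) × (ℕ → ℝ) × (ℕ → ℝ)) =>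
        ((q.1.2, q.2.1), q.2.2.2.1) by fun_prop) P.measurableSet_misalignmentEvent
  exact (hB.inter (hS _ _)).union ((hB.compl.inter (hA.inter (hS _ _))).union
    (hB.compl.inter (hA.compl.inter (hS _ _))))

/-! ### Almost sure decomposition of coverage into beam events -/

/-- The typical user lies in the coverage of the `j`-th beam and would have SINR at least `T` if
served through that beam. -/
def coveredBy (T : ℝ) (j : ℕ) : Set Ω :=
  {ω | M.d ω ∈ P.beamCell j ∧ (M.Zd ω, M.Zψ ω, M.env ω) ∈ beamEvent P T j (M.d ω) (M.ψ ω)}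

theorem measurable_data : Measurable
    (fun ω => ((M.da ω, M.d ω), M.ψ ω, M.Zd ω, M.Zψ ω, M.env ω)) :=
  (M.measurable_da.prodMk M.measurable_d).prodMk (M.measurable_ψ.prodMk (M.measurable_Zd.prodMk
    (M.measurable_Zψ.prodMk M.measurable_env)))

theorem measurableSet_coveredBy (T : ℝ) (j : ℕ) : MeasurableSet (M.coveredBy T j) :=
  (M.measurable_d (P.measurableSet_beamCell j)).inter
    (M.measurable_data (measurableSet_beamEvent P T j))

theorem userSINR_of_beamIndex_eq {T : ℝ} {j : ℕ} {ω : Ω} (h : P.beamIndex (M.d ω) = j) :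
    ENNReal.ofReal T ≤ M.userSINR ω ↔
      (M.Zd ω, M.Zψ ω, M.env ω) ∈ beamEvent P T j (M.d ω) (M.ψ ω) := by
  rw [userSINR, h]
  simp only [beamEvent, Set.mem_ofPred_eq, sinr_eq, dHat, ψHat]
  by_cases h₁ : M.d ω + Real.sqrt (P.varDist (M.d ω)) * M.Zd ω ∈ P.beamCell j
  · by_cases h₂ : P.ν ≤ |M.ψ ω - (M.ψ ω + Real.sqrt (P.varAngle (M.d ω) (M.ψ ω)) * M.Zψ ω)| <;>
      simp only [h₁, h₂, not_true_eq_false, not_false_eq_true, true_and, false_and, or_false,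
        false_or, if_true, if_false]
  · simp only [h₁, not_false_eq_true, not_true_eq_false, true_and, false_and, or_false, if_true]

theorem ae_notMem_of_volume_eq_zero (M : Model P μ) {s : Set (ℝ × ℝ)} (hs : volume s = 0) :
    ∀ᵐ ω ∂μ, (M.da ω, M.d ω) ∉ s := by
  have h : (μ.map fun ω => (M.da ω, M.d ω)) s = 0 := by
    rw [M.law_da_d]
    exact withDensity_absolutelyContinuous _ _ hs
  exact ae_of_ae_map (M.measurable_da.prodMk M.measurable_d).aemeasurable
    (measure_eq_zero_iff_ae_notMem.1 h)

theorem ae_d_ne (c : ℝ) : ∀ᵐ ω ∂μ, M.d ω ≠ c := by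
  have h : (volume : Measure (ℝ × ℝ)) (Set.univ ×ˢ {c}) = 0 := by
    rw [Measure.volume_eq_prod, Measure.prod_prod]
    simp
  filter_upwards [M.ae_notMem_of_volume_eq_zero h] with ω hω
  simpa using hω

theorem ae_d_mem_Ioc : ∀ᵐ ω ∂μ, 0 < M.d ω ∧ M.d ω ≤ M.da ω := by
  have h : ∀ᵐ p ∂(μ.map fun ω => (M.da ω, M.d ω)), 0 ≤ p.2 ∧ p.2 ≤ p.1 := by
    have h1 := measurable_userDensity
    have h2 := measurable_interBSDensity P.lam
    rw [M.law_da_d, ae_withDensity_iff (by fun_prop)]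
    refine Filter.Eventually.of_forall fun p hp => ?_
    by_contra hn
    simp [userDensity, hn] at hp
  filter_upwards [ae_of_ae_map (M.measurable_da.prodMk M.measurable_d).aemeasurable h,
    M.ae_d_ne 0] with ω h1 h2
  exact ⟨lt_of_le_of_ne h1.1 h2.symm, h1.2⟩

theorem ae_mem_beamCell_iff : ∀ᵐ ω ∂μ, ∀ j : ℕ, 1 ≤ j → j ≤ P.maxBeams →
    (M.d ω ∈ P.beamCell j ↔ P.beamIndex (M.d ω) = j) := by
  filter_upwards [ae_all_iff.2 fun j => M.ae_d_ne (P.beamLeft j)] with ω h j hj hJ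
  exact P.mem_beamCell_iff_beamIndex_eq hj (P.lt_pi_div_two_of_le_maxBeams hj hJ) (h j)

/-- Replaces the random serving index by the constant `j`, which is legitimate inside the cell off
its left endpoint. The right-hand event has the product structure needed for Tonelli. -/
theorem covered_ae_eq {j : ℕ} (hj : 1 ≤ j) (hJ : j ≤ P.maxBeams) (T : ℝ) :
    {ω | M.d ω ∈ P.beamCell j ∧ ENNReal.ofReal T ≤ M.userSINR ω} =ᵐ[μ] M.coveredBy T j := by
  filter_upwards [M.ae_mem_beamCell_iff] with ω h
  refine propext (and_congr_right fun hd => ?_)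
  exact M.userSINR_of_beamIndex_eq ((h j hj hJ).1 hd)

theorem overallCoverage_eq_sum [IsProbabilityMeasure μ] (T : ℝ) :
    M.overallCoverage T = ∑ j ∈ Finset.Icc 1 P.maxBeams, μ.real (M.coveredBy T j) := by
  -- The events are disjoint only almost surely, since adjacent cells share an endpoint.
  rw [← measureReal_biUnion_finset₀]
  · refine measureReal_congr ?_
    filter_upwards [M.ae_mem_beamCell_iff, M.ae_d_mem_Ioc] with ω h hd
    refine propext ?_
    have hi := h _ (P.beamIndex_pos hd.1) (P.beamIndex_le_maxBeams _)
    change _ ≤ _ ↔ ω ∈ ⋃ j ∈ Finset.Icc 1 P.maxBeams, M.coveredBy T j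
    simp only [Set.mem_iUnion, Finset.mem_Icc, exists_prop]
    constructor
    · intro hT
      exact ⟨_, ⟨P.beamIndex_pos hd.1, P.beamIndex_le_maxBeams _⟩, hi.2 rfl,
        (M.userSINR_of_beamIndex_eq rfl).1 hT⟩
    · rintro ⟨j, ⟨hj, hJ⟩, hc, hT⟩
      exact (M.userSINR_of_beamIndex_eq ((h j hj hJ).1 hc)).2 hT
  · intro i hi j hj hij
    rw [Finset.coe_Icc, Set.mem_Icc] at hi hj
    rw [Function.onFun, AEDisjoint, measure_eq_zero_iff_ae_notMem]
    filter_upwards [M.ae_mem_beamCell_iff] with ω h hω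
    exact hij (((h i hi.1 hi.2).1 hω.1.1).symm.trans ((h j hj.1 hj.2).1 hω.2.1))
  · exact fun j _ => (M.measurableSet_coveredBy T j).nullMeasurableSet

/-! ### Disintegration over cell length, distance and angle -/

/-- Disintegration of the event of being covered through the `j`-th beam. -/
theorem measure_coveredBy_inter [IsProbabilityMeasure μ] (T : ℝ) (j : ℕ) {A : Set ℝ}
    (hA : MeasurableSet A) :
    μ (M.da ⁻¹' A ∩ M.coveredBy T j) = ∫⁻ y, ENNReal.ofReal (interBSDensity P.lam y) *
      (A.indicator 1 y * ∫⁻ x in P.beamCell j, ENNReal.ofReal (userDensity y x) *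
        ∫⁻ ψ, ENNReal.ofReal (M.beamCoverageAt T j x ψ) ∂(μ.map M.ψ)) := by
  have := Measure.isProbabilityMeasure_map (μ := μ) M.measurable_env.aemeasurable
  have := Measure.isProbabilityMeasure_map (μ := μ) M.measurable_ψ.aemeasurable
  have hq : Measurable fun x => ∫⁻ ψ, ENNReal.ofReal (M.beamCoverageAt T j x ψ) ∂(μ.map M.ψ) :=
    (M.measurable_beamCoverageAt T j).ennreal_ofReal.lintegral_prod_right'
  let D : Set ((ℝ × ℝ) × ℝ × ℝ × ℝ × ((ℕ → ℝ) × (ℕ → ℝ) × (ℕ → ℝ))) :=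
    {q | q.1 ∈ A ×ˢ P.beamCell j} ∩ {q | q.2.2 ∈ beamEvent P T j q.1.2 q.2.1}
  have hD : MeasurableSet D := (measurable_fst (hA.prod (P.measurableSet_beamCell j))).inter
    (measurableSet_beamEvent P T j)
  -- With `(da, d) = p` fixed, the fibre is empty off the cell; otherwise integrating out errors and
  -- environment leaves an average over the angle.
  have hfib : ∀ p : ℝ × ℝ, ((μ.map M.ψ).prod ((gaussianReal 0 1).prod
      ((gaussianReal 0 1).prod (μ.map M.env)))) (Prod.mk p ⁻¹' D) =
      (A ×ˢ P.beamCell j).indicator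
        (fun p => ∫⁻ ψ, ENNReal.ofReal (M.beamCoverageAt T j p.2 ψ) ∂(μ.map M.ψ)) p := by
    intro p
    by_cases hp : p ∈ A ×ˢ P.beamCell j
    · rw [Set.indicator_of_mem hp, Measure.prod_apply (measurable_prodMk_left hD)]
      refine lintegral_congr fun ψ => ?_
      rw [← measure_beamEvent, ofReal_measureReal]
      congr 1
      ext r
      simp only [D, Set.mem_preimage, Set.mem_inter_iff, Set.mem_ofPred_eq, hp, true_and]
    · rw [Set.indicator_of_notMem hp, show Prod.mk p ⁻¹' D = ∅ from ?_, measure_empty]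
      ext r
      simp only [D, Set.mem_preimage, Set.mem_inter_iff, Set.mem_ofPred_eq, hp, false_and,
        Set.mem_empty_iff_false]
  have h1 : μ (M.da ⁻¹' A ∩ M.coveredBy T j) =
      μ.map (fun ω => ((M.da ω, M.d ω), M.ψ ω, M.Zd ω, M.Zψ ω, M.env ω)) D := by
    rw [Measure.map_apply M.measurable_data hD]
    congr 1
    ext ω
    simp [D, coveredBy, and_assoc]
  rw [h1, indep_env, Measure.prod_apply hD, lintegral_congr hfib, M.law_da_d,
    lintegral_law_da_d _ (Measurable.indicator (hq.fun_comp measurable_snd)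
      (hA.prod (P.measurableSet_beamCell j)))]
  refine lintegral_congr fun y => ?_
  congr 1
  rw [← lintegral_indicator (P.measurableSet_beamCell j), ← lintegral_const_mul' _ _ (by
    by_cases h : y ∈ A <;> simp [h])]
  refine lintegral_congr fun x => ?_
  by_cases hy : y ∈ A <;> by_cases hx : x ∈ P.beamCell j <;> simp [hy, hx]

/-! ### Beam coverage as a Lebesgue integral -/

theorem _root_.MmWave.measurable_of_ofReal {α : Type*} [MeasurableSpace α] {f : α → ℝ}
    (hf : Measurable fun a => ENNReal.ofReal (f a)) (h0 : ∀ a, 0 ≤ f a) : Measurable f := by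
  have h := hf.ennreal_toReal
  simpa only [ENNReal.toReal_ofReal (h0 _)] using h

theorem integrable_userDensity (y : ℝ) : Integrable (userDensity y) := by
  have hm : Measurable (userDensity y) := measurable_userDensity.comp measurable_prodMk_left
  refine ⟨hm.aestronglyMeasurable, ?_⟩
  rw [hasFiniteIntegral_iff_ofReal (Filter.Eventually.of_forall (userDensity_nonneg y))]
  exact (lintegral_userDensity_ne_top y).lt_top

theorem integral_angleDensity_mul (f : ℝ → ℝ) :
    ∫ ψ in (0 : ℝ)..(2 * Real.pi), f ψ * angleDensity ψ = ∫ ψ, f ψ * angleDensity ψ := by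
  rw [intervalIntegral.integral_of_le (by positivity), ← integral_Icc_eq_integral_Ioc]
  refine setIntegral_eq_integral_of_forall_compl_eq_zero fun ψ hψ => ?_
  have h : ¬(0 ≤ ψ ∧ ψ ≤ 2 * Real.pi) := hψ
  simp [angleDensity, h]

theorem law_ψ_lintegral {f : ℝ → ℝ≥0∞} (hf : Measurable f) :
    ∫⁻ ψ, f ψ ∂(μ.map M.ψ) = ∫⁻ ψ, ENNReal.ofReal (angleDensity ψ) * f ψ := by
  rw [M.law_ψ, lintegral_withDensity_eq_lintegral_mul _ measurable_angleDensity.ennreal_ofReal hf]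
  rfl

/-- The law of `da` is the first marginal of the joint law: `userDensity y` has mass one for `y >
0`, and for `y < 0` the outer density vanishes. The point `y = 0`, where that mass is zero, is
negligible. -/
theorem lintegral_da {f : ℝ → ℝ≥0∞} (hf : Measurable f) :
    ∫⁻ ω, f (M.da ω) ∂μ = ∫⁻ y, ENNReal.ofReal (interBSDensity P.lam y) * f y := by
  have h := lintegral_map (μ := μ) (hf.fun_comp measurable_fst)
    (M.measurable_da.prodMk M.measurable_d)
  rw [← h, M.law_da_d, lintegral_law_da_d _ (hf.fun_comp measurable_fst)]
  refine lintegral_congr_ae ?_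
  filter_upwards [Measure.ae_ne volume (0 : ℝ)] with y hy
  rcases hy.lt_or_gt with hy | hy
  · simp [interBSDensity, hy.not_ge]
  · have hu : Measurable (userDensity y) := measurable_userDensity.comp measurable_prodMk_left
    rw [lintegral_mul_const _ hu.ennreal_ofReal, lintegral_userDensity hy, one_mul]

/-- Coverage probability through the `j`-th beam in a cell of length `y` for a fixed angle of
arrival. -/
noncomputable def beamCoverageAngle (T y : ℝ) (j : ℕ) (ψ : ℝ) : ℝ :=
  ∫ x in P.beamCell j, M.beamCoverageAt T j x ψ * userDensity y x

theorem beamCoverage_eq_integral (T y : ℝ) (j : ℕ) :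
    M.beamCoverage T y j = ∫ ψ, M.beamCoverageAngle T y j ψ * angleDensity ψ := by
  rw [← integral_angleDensity_mul]
  refine intervalIntegral.integral_congr fun ψ _ => ?_
  exact integral_mul_const _ _

variable [IsProbabilityMeasure μ]

theorem beamCoverageAt_mul_nonneg (T y : ℝ) (j : ℕ) (x ψ : ℝ) :
    0 ≤ M.beamCoverageAt T j x ψ * userDensity y x :=
  mul_nonneg (M.beamCoverageAt_mem_Icc T j x ψ).1 (userDensity_nonneg y x)

theorem beamCoverageAt_mul_le (T y : ℝ) (j : ℕ) (x ψ : ℝ) :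
    M.beamCoverageAt T j x ψ * userDensity y x ≤ userDensity y x :=
  mul_le_of_le_one_left (userDensity_nonneg y x) (M.beamCoverageAt_mem_Icc T j x ψ).2

theorem measurable_beamCoverageAt_mul (T y : ℝ) (j : ℕ) : Measurable fun p : ℝ × ℝ =>
    M.beamCoverageAt T j p.2 p.1 * userDensity y p.2 := by
  have hu : Measurable fun p : ℝ × ℝ => userDensity y p.2 :=
    measurable_userDensity.fun_comp (measurable_const.prodMk measurable_snd)
  have hQ : Measurable fun p : ℝ × ℝ => M.beamCoverageAt T j p.2 p.1 :=
    (M.measurable_beamCoverageAt T j).fun_comp (measurable_snd.prodMk measurable_fst)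
  exact hQ.fun_mul hu

theorem beamCoverageAngle_nonneg (T y : ℝ) (j : ℕ) (ψ : ℝ) : 0 ≤ M.beamCoverageAngle T y j ψ :=
  integral_nonneg fun x => M.beamCoverageAt_mul_nonneg T y j x ψ

theorem ofReal_beamCoverageAngle (T y : ℝ) (j : ℕ) (ψ : ℝ) :
    ENNReal.ofReal (M.beamCoverageAngle T y j ψ) =
      ∫⁻ x in P.beamCell j, ENNReal.ofReal (M.beamCoverageAt T j x ψ * userDensity y x) := by
  have hm : Measurable fun x => M.beamCoverageAt T j x ψ * userDensity y x := by
    have h := (M.measurable_beamCoverageAt_mul T y j).comp (measurable_prodMk_left (x := ψ))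
    simpa only [Function.comp_def] using h
  refine ofReal_integral_eq_lintegral_ofReal (Integrable.integrableOn ?_)
    (Filter.Eventually.of_forall fun x => M.beamCoverageAt_mul_nonneg T y j x ψ)
  refine (integrable_userDensity y).mono' hm.aestronglyMeasurable
    (Filter.Eventually.of_forall fun x => ?_)
  rw [Real.norm_of_nonneg (M.beamCoverageAt_mul_nonneg T y j x ψ)]
  exact M.beamCoverageAt_mul_le T y j x ψ

theorem measurable_beamCoverageAngle (T y : ℝ) (j : ℕ) :
    Measurable (M.beamCoverageAngle T y j) := by
  refine measurable_of_ofReal ?_ (M.beamCoverageAngle_nonneg T y j)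
  simp_rw [ofReal_beamCoverageAngle]
  exact (M.measurable_beamCoverageAt_mul T y j).ennreal_ofReal.lintegral_prod_right'

theorem lintegral_beamCoverageAngle (T y : ℝ) (j : ℕ) :
    ∫⁻ ψ, ENNReal.ofReal (M.beamCoverageAngle T y j ψ * angleDensity ψ) =
      ∫⁻ ψ, ENNReal.ofReal (M.beamCoverageAngle T y j ψ) ∂(μ.map M.ψ) := by
  rw [M.law_ψ_lintegral (M.measurable_beamCoverageAngle T y j).ennreal_ofReal]
  refine lintegral_congr fun ψ => ?_
  rw [ENNReal.ofReal_mul (M.beamCoverageAngle_nonneg T y j ψ), mul_comm]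

theorem ofReal_beamCoverage_eq_lintegral (T y : ℝ) (j : ℕ) :
    ENNReal.ofReal (M.beamCoverage T y j) =
      ∫⁻ ψ, ENNReal.ofReal (M.beamCoverageAngle T y j ψ) ∂(μ.map M.ψ) := by
  have := Measure.isProbabilityMeasure_map (μ := μ) M.measurable_ψ.aemeasurable
  have h0 : ∀ ψ, 0 ≤ M.beamCoverageAngle T y j ψ * angleDensity ψ := fun ψ =>
    mul_nonneg (M.beamCoverageAngle_nonneg T y j ψ) (angleDensity_nonneg ψ)
  have hle : ∀ ψ, ENNReal.ofReal (M.beamCoverageAngle T y j ψ) ≤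
      ∫⁻ x, ENNReal.ofReal (userDensity y x) := fun ψ => by
    rw [ofReal_beamCoverageAngle]
    exact (setLIntegral_le_lintegral _ _).trans
      (lintegral_mono fun x => ENNReal.ofReal_le_ofReal (M.beamCoverageAt_mul_le T y j x ψ))
  have hi : Integrable fun ψ => M.beamCoverageAngle T y j ψ * angleDensity ψ := by
    refine ⟨((M.measurable_beamCoverageAngle T y j).mul
      measurable_angleDensity).aestronglyMeasurable, ?_⟩
    rw [hasFiniteIntegral_iff_ofReal (Filter.Eventually.of_forall h0), lintegral_beamCoverageAngle]
    refine (lintegral_mono hle).trans_lt ?_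
    rw [lintegral_const, measure_univ, mul_one]
    exact (lintegral_userDensity_ne_top y).lt_top
  rw [beamCoverage_eq_integral,
    ofReal_integral_eq_lintegral_ofReal hi (Filter.Eventually.of_forall h0),
    lintegral_beamCoverageAngle]

/-- Tonelli exchanges angle and distance, bringing the Bochner double integral into the form in
which the disintegration delivers it. -/
theorem ofReal_beamCoverage (T y : ℝ) (j : ℕ) : ENNReal.ofReal (M.beamCoverage T y j) =
    ∫⁻ x in P.beamCell j, ENNReal.ofReal (userDensity y x) *
      ∫⁻ ψ, ENNReal.ofReal (M.beamCoverageAt T j x ψ) ∂(μ.map M.ψ) := by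
  have := Measure.isProbabilityMeasure_map (μ := μ) M.measurable_ψ.aemeasurable
  simp_rw [ofReal_beamCoverage_eq_lintegral, ofReal_beamCoverageAngle]
  rw [lintegral_lintegral_swap
    (M.measurable_beamCoverageAt_mul T y j).ennreal_ofReal.aemeasurable]
  refine lintegral_congr fun x => ?_
  have hx : Measurable fun ψ => M.beamCoverageAt T j x ψ := by
    have h := (M.measurable_beamCoverageAt T j).comp (measurable_prodMk_left (x := x))
    simpa only [Function.comp_def] using h
  rw [← lintegral_const_mul _ hx.ennreal_ofReal]
  refine lintegral_congr fun ψ => ?_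
  rw [ENNReal.ofReal_mul (M.beamCoverageAt_mem_Icc T j x ψ).1, mul_comm]

theorem beamCoverage_nonneg (T y : ℝ) (j : ℕ) : 0 ≤ M.beamCoverage T y j := by
  refine intervalIntegral.integral_nonneg (by positivity) fun ψ _ => integral_nonneg fun x => ?_
  exact mul_nonneg (mul_nonneg (M.beamCoverageAt_mem_Icc T j x ψ).1 (userDensity_nonneg y x))
    (angleDensity_nonneg ψ)

theorem measurable_beamCoverage (T : ℝ) (j : ℕ) : Measurable fun y => M.beamCoverage T y j := by
  have := Measure.isProbabilityMeasure_map (μ := μ) M.measurable_ψ.aemeasurable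
  have hq : Measurable fun x => ∫⁻ ψ, ENNReal.ofReal (M.beamCoverageAt T j x ψ) ∂(μ.map M.ψ) :=
    (M.measurable_beamCoverageAt T j).ennreal_ofReal.lintegral_prod_right'
  have hu := measurable_userDensity
  have hm : Measurable fun p : ℝ × ℝ => ENNReal.ofReal (userDensity p.1 p.2) *
      ∫⁻ ψ, ENNReal.ofReal (M.beamCoverageAt T j p.2 ψ) ∂(μ.map M.ψ) :=
    hu.ennreal_ofReal.mul (hq.fun_comp measurable_snd)
  have h : Measurable fun y => ENNReal.ofReal (M.beamCoverage T y j) := by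
    simp_rw [ofReal_beamCoverage]
    exact hm.lintegral_prod_right'
  exact measurable_of_ofReal h (M.beamCoverage_nonneg T · j)

/-! ### Total and conditional probabilities of the beam events -/

theorem measure_coveredBy_inter_eq_setLIntegral (T : ℝ) (j : ℕ) {A : Set ℝ}
    (hA : MeasurableSet A) : μ (M.da ⁻¹' A ∩ M.coveredBy T j) =
      ∫⁻ y in A, ENNReal.ofReal (M.beamCoverage T y j * interBSDensity P.lam y) := by
  rw [M.measure_coveredBy_inter T j hA, ← lintegral_indicator hA]
  refine lintegral_congr fun y => ?_
  rw [← ofReal_beamCoverage]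
  by_cases hy : y ∈ A
  · rw [Set.indicator_of_mem hy, Set.indicator_of_mem hy, Pi.one_apply, one_mul,
      ENNReal.ofReal_mul (M.beamCoverage_nonneg T y j), mul_comm]
  · simp [hy]

theorem measure_coveredBy (T : ℝ) (j : ℕ) : μ (M.coveredBy T j) =
    ∫⁻ y, ENNReal.ofReal (M.beamCoverage T y j * interBSDensity P.lam y) := by
  simpa using M.measure_coveredBy_inter_eq_setLIntegral T j MeasurableSet.univ

theorem beamCoverage_mul_nonneg (T y : ℝ) (j : ℕ) :
    0 ≤ M.beamCoverage T y j * interBSDensity P.lam y :=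
  mul_nonneg (M.beamCoverage_nonneg T y j) (interBSDensity_nonneg P.lam_pos y)

theorem integrable_beamCoverage_mul (T : ℝ) (j : ℕ) :
    Integrable fun y => M.beamCoverage T y j * interBSDensity P.lam y := by
  refine ⟨((M.measurable_beamCoverage T j).mul
    (measurable_interBSDensity P.lam)).aestronglyMeasurable, ?_⟩
  rw [hasFiniteIntegral_iff_ofReal (Filter.Eventually.of_forall (M.beamCoverage_mul_nonneg T · j)),
    ← measure_coveredBy]
  -- The integral is a probability, so integrability needs no estimate.
  exact measure_lt_top _ _

theorem measureReal_coveredBy (T : ℝ) (j : ℕ) : μ.real (M.coveredBy T j) =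
    ∫ y, M.beamCoverage T y j * interBSDensity P.lam y := by
  rw [integral_eq_lintegral_of_nonneg_ae
    (Filter.Eventually.of_forall (M.beamCoverage_mul_nonneg T · j))
    (M.integrable_beamCoverage_mul T j).aestronglyMeasurable, ← measure_coveredBy]
  rfl

theorem setLIntegral_beamCoverage_da (T : ℝ) (j : ℕ) {A : Set ℝ} (hA : MeasurableSet A) :
    ∫⁻ ω in M.da ⁻¹' A, ENNReal.ofReal (M.beamCoverage T (M.da ω) j) ∂μ =
      μ (M.da ⁻¹' A ∩ M.coveredBy T j) := by
  have hb := (M.measurable_beamCoverage T j).ennreal_ofReal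
  rw [M.measure_coveredBy_inter_eq_setLIntegral T j hA, ← lintegral_indicator hA,
    ← lintegral_indicator (M.measurable_da hA)]
  have h := M.lintegral_da (hb.indicator hA)
  refine (Eq.trans ?_ h).trans ?_
  · rfl
  · refine lintegral_congr fun y => ?_
    by_cases hy : y ∈ A
    · rw [Set.indicator_of_mem hy, Set.indicator_of_mem hy,
        ENNReal.ofReal_mul (M.beamCoverage_nonneg T y j), mul_comm]
    · simp [hy]

/-- Every event of the σ-algebra generated by `da` is a preimage `da ⁻¹' A`, so the defining
property of conditional expectation is exactly the disintegration on `A`. -/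
theorem condExp_coveredBy (T : ℝ) (j : ℕ) :
    (fun ω => M.beamCoverage T (M.da ω) j) =ᵐ[μ]
      μ⟦M.coveredBy T j | MeasurableSpace.comap M.da inferInstance⟧ := by
  have hb : Measurable fun ω => M.beamCoverage T (M.da ω) j :=
    (M.measurable_beamCoverage T j).fun_comp M.measurable_da
  have h0 : ∀ ω, 0 ≤ M.beamCoverage T (M.da ω) j := fun ω => M.beamCoverage_nonneg T _ j
  have hc := M.measurableSet_coveredBy T j
  refine ae_eq_condExp_of_forall_setIntegral_eq M.measurable_da.comap_le
    ((integrable_const _).indicator hc) ?_ ?_ ?_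
  · rintro _ ⟨A, hA, rfl⟩ _
    refine ⟨hb.aestronglyMeasurable, ?_⟩
    rw [hasFiniteIntegral_iff_ofReal (Filter.Eventually.of_forall h0),
      M.setLIntegral_beamCoverage_da T j hA]
    exact measure_lt_top _ _
  · rintro _ ⟨A, hA, rfl⟩ _
    rw [integral_eq_lintegral_of_nonneg_ae (Filter.Eventually.of_forall h0)
      hb.aestronglyMeasurable, M.setLIntegral_beamCoverage_da T j hA, setIntegral_indicator hc,
      setIntegral_const, smul_eq_mul, mul_one]
    rfl
  · exact ((M.measurable_beamCoverage T j).fun_comp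
      (comap_measurable M.da)).stronglyMeasurable.aestronglyMeasurable

/-! ### Beams beyond the cell, and the conclusion -/

theorem beamCoverage_eq_zero {j : ℕ} {y : ℝ} (T : ℝ) (hj : 1 ≤ j) (hJ : j ≤ P.maxBeams)
    (h : P.numBeams y < j) : M.beamCoverage T y j = 0 := by
  rw [← ENNReal.toReal_ofReal (M.beamCoverage_nonneg T y j), ofReal_beamCoverage,
    setLIntegral_congr_fun_ae (g := fun _ => 0) (P.measurableSet_beamCell j), lintegral_zero,
    ENNReal.toReal_zero]
  -- The cell starts at or beyond `y`, so only the point `x = y` could lie in the support of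
  -- `userDensity y`.
  filter_upwards [Measure.ae_ne volume y] with x hxy hx
  have hyx : y < x := lt_of_le_of_ne
    ((P.le_beamLeft_of_numBeams_lt hj hJ h).trans hx.1) hxy.symm
  simp [userDensity, hyx.not_ge]

theorem sum_beamCoverage_eq (T y : ℝ) :
    ∑ j ∈ Finset.Icc 1 (P.numBeams y), M.beamCoverage T y j =
      ∑ j ∈ Finset.Icc 1 P.maxBeams, M.beamCoverage T y j := by
  refine Finset.sum_subset (Finset.Icc_subset_Icc_right (P.numBeams_le_maxBeams y)) ?_
  intro j hj hn
  rw [Finset.mem_Icc] at hj hn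
  exact M.beamCoverage_eq_zero T hj.1 hj.2 (by lia)

end Model

end MmWave

theorem mainTheorem6 {Ω : Type*} [MeasurableSpace Ω] (μ : Measure Ω) [IsProbabilityMeasure μ]
    (P : MmWave.Params) (M : MmWave.Model P μ) (T : ℝ) (hT : 0 < T) :
    (∀ j : ℕ, 1 ≤ j → ∀ᵐ ω ∂μ, j ≤ P.numBeams (M.da ω) →
      (μ⟦{ω' | M.d ω' ∈ P.beamCell j ∧ ENNReal.ofReal T ≤ M.userSINR ω'} |
          MeasurableSpace.comap M.da inferInstance⟧) ω = M.beamCoverage T (M.da ω) j) ∧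
    MeasureTheory.Integrable
      (fun y => (∑ j ∈ Finset.Icc 1 (P.numBeams y), M.beamCoverage T y j) *
        MmWave.interBSDensity P.lam y) ∧
    M.overallCoverage T =
      ∫ y, (∑ j ∈ Finset.Icc 1 (P.numBeams y), M.beamCoverage T y j) *
        MmWave.interBSDensity P.lam y := by
  simp_rw [M.sum_beamCoverage_eq, Finset.sum_mul]
  refine ⟨fun j hj => ?_, integrable_finsetSum _ fun j _ => M.integrable_beamCoverage_mul T j, ?_⟩
  · by_cases hJ : j ≤ P.maxBeams
    · have h := condExp_congr_ae (m := MeasurableSpace.comap M.da inferInstance)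
        (indicator_ae_eq_of_ae_eq_set (f := fun _ => (1 : ℝ)) (M.covered_ae_eq hj hJ T))
      filter_upwards [h, M.condExp_coveredBy T j] with ω h₁ h₂ _
      rw [h₁, h₂]
    -- Beyond `maxBeams` no cell has a `j`-th beam, so the conditional claim is vacuous.
    · exact Filter.Eventually.of_forall fun ω h => absurd (h.trans (P.numBeams_le_maxBeams _)) hJ
  · rw [M.overallCoverage_eq_sum, integral_finsetSum _ fun j _ => M.integrable_beamCoverage_mul T j]
    exact Finset.sum_congr rfl fun j _ => M.measureReal_coveredBy T j
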